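/- **Definitions.** Let $\mathrm{FRel}$ be the category of finite sets and binary relations, with composition of relations. Let $\mathrm{Endo}(\mathrm{FRel})$ be the category whose objects are pairs $(X,R)$, with $X$ a finite set and $R\subset X\times X$, and whose morphisms $(X,R)\to(X',R')$ are the relations $S\subset X\times X'$ with $R'\circ S=S\circ R$. The Szymczak category $\mathrm{Szym}(\mathrm{FRel})$ has the same objects. Its morphisms $(X,R)\to(X',R')$ are the classes $[S,m]$ of pairs ($S$ a morphism of $\mathrm{Endo}(\mathrm{FRel})$, $m\in\mathbb N$) under $$(S,m)\equiv(S',m')\iff S\circ R^{m'+k}=S'\circ R^{m+k}\text{ for some }k\in\mathbb N,$$ with composition $[S',m']\circ[S,m]=[S'\circ S,m+m']$. For $R\subset X\times X$, two points are *strongly connected* if there are walks of positive length in $R$ in both directions between them. The *components* $[x]_R$ are the classes of this relation on the set $X_R$ of points strongly connected with themselves. The *period* $q_U$ of a component $U$ is the greatest common divisor of the lengths of all cycles of $R|_U$. The object $(X,R)$ is in *canonical form* if $X=X_R$, the restriction of $R$ to each component is a bijection, and there is $p\ge 1$ with $R^{i+p}=R^i$ for all $i\geq p$ such that in fact $R^{n+p}=R^n$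 for all $n\ge1$. Let $(X,R)$ be in canonical form. For $x',x''$ in a component $U$ let $l_U(x',x'')$ be the residue modulo $q_U$ of any $m$ with $x''\in (R|_U)^m(x')$. For components $U,V$ define an equivalence relation on $U\times V$ by $$(x',y')\sim_{UV}(x'',y'')\iff l_U(x',x'')\equiv l_V(y',y'')\pmod{\gcd(q_U,q_V)},$$ and let the *number of connections* $l_{UV}(R)$ be the number of classes of $\sim_{UV}$ that contain a pair belonging to $R$. A *classifying graph* of an object $(X,R)$ of $\mathrm{Endo}(\mathrm{FRel})$ is the labelled digraph obtained as follows from an object $(\bar X,\bar R)$ in canonical form that is isomorphic to $(X,R)$ in $\mathrm{Szym}(\mathrm{FRel})$. Its vertices are the components of $\bar R$, the vertex $U$ being labelled by $q_U$. Its edges are the pairs $(U,V)$ with $U\ne V$ and $l_{UV}(\bar R)\neq0$, the edge $(U,V)$ being labelled by $l_{UV}(\bar R)$. **Theorem.** Let $(X,R)$ and $(X',R')$ be isomorphic in $\mathrm{Szym}(\mathrm{FRel})$. Then both have a classifying graph, and for every classifying graph $G$ of $(X,R)$ and every classifying graph $G'$ of $(X',R')$ there is an isomorphism of directed graphs $G\to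 G'$ which preserves the labels of vertices and edges. -/

import Mathlib

open CategoryTheory
open scoped SetRel

universe v u

/-! ### The category of endomorphisms -/

/-- Objects `(E, e)` of `Endo(𝓔)`: an object `E` of `𝓔` with an endomorphism `e : E ⟶ E`. -/
structure EndoCat (C : Type u) [Category.{v} C] where
  obj : C
  endo : End obj

namespace EndoCat

variable {C : Type u} [Category.{v} C]

/-- Morphisms of `Endo(𝓔)`: the morphisms of `𝓔` commuting with the endomorphisms. -/
@[ext]
structure Hom (A B : EndoCat C) where
  hom : A.obj ⟶ B.obj
  comm : hom ≫ B.endo = A.endo ≫ hom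

instance : Category (EndoCat C) where
  Hom := Hom
  id A := ⟨𝟙 A.obj, by rw [Category.id_comp, Category.comp_id]⟩
  comp f g := ⟨f.hom ≫ g.hom, by
    rw [Category.assoc, g.comm, ← Category.assoc, f.comm, Category.assoc]⟩
  id_comp f := Hom.ext (Category.id_comp f.hom)
  comp_id f := Hom.ext (Category.comp_id f.hom)
  assoc f g h := Hom.ext (Category.assoc f.hom g.hom h.hom)

theorem pow_comm {A B : EndoCat C} (f : A ⟶ B) (n : ℕ) :
    f.hom ≫ (B.endo ^ n : End B.obj) = (A.endo ^ n : End A.obj) ≫ f.hom := by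
  induction n with
  | zero => exact (Category.comp_id f.hom).trans (Category.id_comp f.hom).symm
  | succ n ih =>
    rw [pow_succ', pow_succ', End.mul_def, End.mul_def, ← Category.assoc, ih, Category.assoc,
      f.comm, Category.assoc]

theorem pow_add_comp (A : EndoCat C) {Z : C} (m n : ℕ) (h : A.obj ⟶ Z) :
    (A.endo ^ (m + n) : End A.obj) ≫ h
      = (A.endo ^ m : End A.obj) ≫ (A.endo ^ n : End A.obj) ≫ h := by
  rw [← Category.assoc, ← End.mul_def, ← pow_add, add_comm]

end EndoCat

/-! ### The Szymczak category -/

/-- The Szymczak category of `𝓔`; its objects are the objects of `Endo(𝓔)`. -/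
structure Szym (C : Type u) [Category.{v} C] where
  of ::
  as : EndoCat C

namespace Szym

variable {C : Type u} [Category.{v} C]

/-- `(φ, m) ≡ (φ', m')` iff `φ ∘ e ^ (m' + k) = φ' ∘ e ^ (m + k)` for some `k`. -/
def homRel (A B : EndoCat C) (p q : (A ⟶ B) × ℕ) : Prop :=
  ∃ k : ℕ, (A.endo ^ (q.2 + k) : End A.obj) ≫ p.1.hom = (A.endo ^ (p.2 + k) : End A.obj) ≫ q.1.hom

theorem homRel_equivalence (A B : EndoCat C) : Equivalence (homRel A B) where
  refl _ := ⟨0, rfl⟩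
  symm := fun ⟨k, h⟩ => ⟨k, h.symm⟩
  trans := by
    rintro ⟨f, a⟩ ⟨g, b⟩ ⟨h, c⟩ ⟨k, h₁⟩ ⟨l, h₂⟩
    refine ⟨b + k + l, ?_⟩
    dsimp only at h₁ h₂ ⊢
    rw [show c + (b + k + l) = (c + l) + (b + k) by ring, EndoCat.pow_add_comp, h₁,
      ← EndoCat.pow_add_comp, show (c + l) + (a + k) = (a + k) + (c + l) by ring,
      EndoCat.pow_add_comp, h₂, ← EndoCat.pow_add_comp]
    congr 2
    ring

/-- The setoid on `Endo(𝓔)(A, B) × ℕ` given by `≡`. -/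
def homSetoid (A B : EndoCat C) : Setoid ((A ⟶ B) × ℕ) := ⟨homRel A B, homRel_equivalence A B⟩

/-- Morphisms of `Szym(𝓔)`: equivalence classes `[φ, m]`. -/
def Hom (A B : Szym C) : Type v := Quotient (homSetoid A.as B.as)

/-- The composition `[φ', m'] ∘ [φ, m] = [φ' ∘ φ, m + m']`, in diagrammatic order. -/
def Hom.comp {A B D : Szym C} : Hom A B → Hom B D → Hom A D :=
  Quotient.lift₂ (fun p q => Quotient.mk (homSetoid A.as D.as) (p.1 ≫ q.1, p.2 + q.2)) (by
    rintro ⟨f, a⟩ ⟨g, b⟩ ⟨f', a'⟩ ⟨g', b'⟩ ⟨k, hk⟩ ⟨l, hl⟩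
    apply Quotient.sound
    refine ⟨k + l, ?_⟩
    change (A.as.endo ^ (a' + b' + (k + l)) : End A.as.obj) ≫ f.hom ≫ g.hom
      = (A.as.endo ^ (a + b + (k + l)) : End A.as.obj) ≫ f'.hom ≫ g'.hom
    dsimp only at hk hl
    rw [show a' + b' + (k + l) = (b' + l) + (a' + k) by ring, EndoCat.pow_add_comp,
      ← Category.assoc (A.as.endo ^ (a' + k) : End A.as.obj), hk, Category.assoc,
      ← EndoCat.pow_add_comp, add_comm (b' + l), EndoCat.pow_add_comp, ← Category.assoc _ f'.hom,
      ← EndoCat.pow_comm, Category.assoc, hl, ← Category.assoc f'.hom, EndoCat.pow_comm,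
      Category.assoc, ← EndoCat.pow_add_comp]
    congr 2
    ring)

instance : Category (Szym C) where
  Hom := Hom
  id A := Quotient.mk (homSetoid A.as A.as) (𝟙 A.as, 0)
  comp := Hom.comp
  id_comp := by
    rintro A B ⟨f, m⟩
    exact congrArg (Quotient.mk (homSetoid A.as B.as))
      (Prod.ext (Category.id_comp f) (Nat.zero_add m))
  comp_id := by
    rintro A B ⟨f, m⟩
    exact congrArg (Quotient.mk (homSetoid A.as B.as))
      (Prod.ext (Category.comp_id f) (Nat.add_zero m))
  assoc := by
    rintro A B D E ⟨f, m⟩ ⟨g, n⟩ ⟨h, l⟩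
    exact congrArg (Quotient.mk (homSetoid A.as E.as))
      (Prod.ext (Category.assoc f g h) (Nat.add_assoc m n l))

end Szym

/-! ### Finite sets and relations -/

/-- The category of finite sets and binary relations. -/
abbrev FRel : Type (u + 1) :=
  ObjectProperty.FullSubcategory (fun X : RelCat.{u} => Finite (show Type u from X))

namespace EndoCat

/-- The underlying finite set `X` of an object `(X, R)` of `Endo(FRel)`. -/
def carrier (A : EndoCat FRel.{u}) : Type u := A.obj.obj

instance (A : EndoCat FRel.{u}) : Finite A.carrier := A.obj.property

/-- The underlying relation `R` of an object `(X, R)` of `Endo(FRel)`. -/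
def rel (A : EndoCat FRel.{u}) : SetRel A.carrier A.carrier :=
  RelCat.Hom.rel (InducedCategory.Hom.hom A.endo)

end EndoCat

/-! ### Relations as directed graphs -/

namespace FinRel

variable {X : Type u}

/-- The powers `R ^ n`; `y ∈ R ^ n (x)` iff there is a walk of length `n` from `x` to `y`. -/
def pow (R : SetRel X X) : ℕ → SetRel X X
  | 0 => SetRel.id
  | n + 1 => pow R n ○ R

/-- The restriction of `R` to `U`, as a relation in `U`. -/
def restrict (R : SetRel X X) (U : Set X) : SetRel U U :=
  {a | ((a.1 : X), (a.2 : X)) ∈ R}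

/-- There is a walk of positive length from `x` to `y`. -/
def Reaches (R : SetRel X X) (x y : X) : Prop :=
  ∃ n : ℕ, 0 < n ∧ (x, y) ∈ pow R n

/-- `x` and `y` are strongly connected in `R`. -/
def StronglyConn (R : SetRel X X) (x y : X) : Prop :=
  Reaches R x y ∧ Reaches R y x

/-- The recurrent set `X_R`. -/
def recurrentSet (R : SetRel X X) : Set X :=
  {x | StronglyConn R x x}

/-- The class `[x]_R`; a strongly connected component if `x` is recurrent. -/
def component (R : SetRel X X) (x : X) : Set X :=
  {y | StronglyConn R x y}

/-- The strongly connected components of `R`: the classes of recurrent vertices. -/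
def components (R : SetRel X X) : Set (Set X) :=
  component R '' recurrentSet R

/-- `R` is (the graph of) a bijective map. -/
def IsBijection (R : SetRel X X) : Prop :=
  ∃ f : X → X, Function.Bijective f ∧ R = Function.graph f

/-- `p` is an eventual period of `R`. -/
def IsEventualPeriod (R : SetRel X X) (p : ℕ) : Prop :=
  1 ≤ p ∧ ∀ i : ℕ, p ≤ i → pow R (i + p) = pow R i

/-- The canonical form: every vertex is recurrent, `R` restricts to a bijection on each strongly
connected component, and `R ^ (n + p) = R ^ n` for all `n ≥ 1`, `p` being an eventual period. -/
structure IsCanonical (R : SetRel X X) : Prop where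
  recurrent : recurrentSet R = Set.univ
  bijective : ∀ x : X, IsBijection (restrict R (component R x))
  periodic : ∃ p : ℕ, IsEventualPeriod R p ∧ ∀ n : ℕ, 1 ≤ n → pow R (n + p) = pow R n

/-- The period of a strongly connected relation: the greatest common divisor of the lengths of all
its cycles. -/
noncomputable def period (R : SetRel X X) : ℕ :=
  sSup {d : ℕ | ∀ (n : ℕ) (x : X), 1 ≤ n → (x, x) ∈ pow R n → d ∣ n}

/-- The period `q_U` of the restriction of `R` to `U`. -/
noncomputable def compPeriod (R : SetRel X X) (U : Set X) : ℕ :=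
  period (restrict R U)

/-- `l_U(x', x'') = m mod q_U` if `x'' ∈ (R|_U) ^ m (x')`. For `R` in canonical form and `U` a
component the residue is the same for all such `m`; here the least such `m` is used. -/
noncomputable def walkResidue (R : SetRel X X) (U : Set X) (x' x'' : U) : ℕ :=
  sInf {m : ℕ | (x', x'') ∈ pow (restrict R U) m} % compPeriod R U

/-- The relation `∼_{UV}` on `U × V`. -/
def ConnEquiv (R : SetRel X X) (U V : Set X) (a b : U × V) : Prop :=
  walkResidue R U a.1 b.1 ≡ walkResidue R V a.2 b.2
    [MOD Nat.gcd (compPeriod R U) (compPeriod R V)]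

/-- The number of connections `l_{UV}(R)`: the number of classes of `∼_{UV}` which contain a pair
belonging to `R`. -/
noncomputable def numConnections (R : SetRel X X) (U V : Set X) : ℕ :=
  Set.ncard {c : Set (U × V) |
    ∃ a : U × V, ((a.1 : X), (a.2 : X)) ∈ R ∧ c = {b | ConnEquiv R U V a b}}

end FinRel

/-! ### Classifying graphs -/

/-- Directed graphs with vertices and edges labelled by natural numbers. -/
structure LabelledDigraph where
  V : Type u
  graph : Digraph V
  vertexLabel : V → ℕ
  edgeLabel : ∀ a b : V, graph.Adj a b → ℕ

/-- Isomorphisms of directed graphs preserving the labels of vertices and edges. -/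
structure LabelledDigraph.Iso (G H : LabelledDigraph.{u}) where
  toRelIso : G.graph.Adj ≃r H.graph.Adj
  vertexLabel_eq : ∀ a : G.V, H.vertexLabel (toRelIso a) = G.vertexLabel a
  edgeLabel_eq : ∀ (a b : G.V) (h : G.graph.Adj a b),
    H.edgeLabel (toRelIso a) (toRelIso b) (toRelIso.map_rel_iff.2 h) = G.edgeLabel a b h

/-- The labelled graph of the components of a relation `R` (in canonical form). -/
noncomputable def componentGraph {X : Type u} (R : SetRel X X) : LabelledDigraph.{u} where
  V := FinRel.components R
  graph := { Adj := fun U V => FinRel.numConnections R U V ≠ 0 ∧ U ≠ V }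
  vertexLabel U := FinRel.compPeriod R U
  edgeLabel U V _ := FinRel.numConnections R U V

/-- `G` is a classifying graph of `A = (X, R)`: it is the graph of components of some object in
canonical form which is isomorphic to `A` in `Szym(FRel)`. -/
def IsClassifyingGraph (A : EndoCat FRel.{u}) (G : LabelledDigraph.{u}) : Prop :=
  ∃ B : EndoCat FRel.{u}, FinRel.IsCanonical B.rel ∧ Nonempty (Szym.of A ≅ Szym.of B) ∧
    G = componentGraph B.rel

/-! ### Powers of a relation and eventual periodicity -/

namespace FinRel

variable {X : Type u}

/-! In the Szymczak category `R` becomes invertible, so only large powers matter; for an eventual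
period `p` the power `R ^ p` is idempotent. Existence splits this idempotent: finiteness routes
every `R ^ p`-step through a point `z` with `(z, z) ∈ R ^ p` (`IsEventualPeriod.exists_mem_self`),
and one representative of each class of mutually related such points carries a canonical form
(`exists_canonical`). Uniqueness is stronger than stated: Szymczak-isomorphic canonical forms are
isomorphic as digraphs. For a common period `q`, the powers `R ^ q` and `R' ^ q` are partial orders
(`IsCanonical.mem_pow_self`, `IsCanonical.antisymm`). An isomorphism normalises to `S`, `T` with
composites exactly `R ^ q` and `R' ^ q`; choosing `x'` with `x S x' T x` then gives a bijection
carrying `R` to `R'` (`IsCanonical.exists_equiv`). All labels are digraph invariants. -/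

theorem pow_one (R : SetRel X X) : pow R 1 = R := SetRel.id_comp R

theorem pow_add (R : SetRel X X) (m n : ℕ) : pow R (m + n) = pow R m ○ pow R n := by
  induction n with
  | zero => exact (SetRel.comp_id _).symm
  | succ n ih =>
    change pow R (m + n) ○ R = pow R m ○ (pow R n ○ R)
    rw [ih, SetRel.comp_assoc]

theorem comp_pow (R : SetRel X X) (n : ℕ) : R ○ pow R n = pow R (n + 1) := by
  rw [Nat.add_comm, pow_add, pow_one]

theorem mem_pow_add {R : SetRel X X} {m n : ℕ} {x y z : X} (h₁ : (x, y) ∈ pow R m)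
    (h₂ : (y, z) ∈ pow R n) : (x, z) ∈ pow R (m + n) := by
  rw [pow_add]
  exact ⟨y, h₁, h₂⟩

theorem mem_pow_mul_self {R : SetRel X X} {n : ℕ} {x : X} (h : (x, x) ∈ pow R n) (k : ℕ) :
    (x, x) ∈ pow R (n * k) := by
  induction k with
  | zero => exact rfl
  | succ k ih => exact mem_pow_add ih h

theorem pow_add_mul {R : SetRel X X} {p n : ℕ} (h : pow R (n + p) = pow R n) (k : ℕ) :
    pow R (n + p * k) = pow R n := by
  induction k with
  | zero => rfl
  | succ k ih => rw [show n + p * (k + 1) = (n + p * k) + p by ring, pow_add, ih, ← pow_add, h]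

theorem pow_add_right {R : SetRel X X} {i d : ℕ} (h : pow R (i + d) = pow R i) {n : ℕ}
    (hn : i ≤ n) : pow R (n + d) = pow R n := by
  obtain ⟨m, rfl⟩ := Nat.exists_eq_add_of_le hn
  rw [show i + m + d = (i + d) + m by ring, pow_add, h, ← pow_add]

/-- Every relation on a finite set is eventually periodic. -/
theorem exists_isEventualPeriod [Finite X] (R : SetRel X X) : ∃ p, IsEventualPeriod R p := by
  have : Finite (SetRel X X) := inferInstanceAs (Finite (Set (X × X)))
  obtain ⟨i, j, hij, h⟩ : ∃ i j, i < j ∧ pow R j = pow R i := by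
    obtain ⟨i, j, hne, h⟩ := Finite.exists_ne_map_eq_of_infinite (pow R)
    rcases hne.lt_or_gt with hlt | hlt
    · exact ⟨i, j, hlt, h.symm⟩
    · exact ⟨j, i, hlt, h⟩
  obtain ⟨d, rfl⟩ := Nat.exists_eq_add_of_le hij.le
  have hd : 1 ≤ d := by omega
  -- A multiple of the gap `d` that is at least `i`, hence past the preperiod.
  refine ⟨d * (i + 1), by nlinarith, fun n hn => ?_⟩
  exact pow_add_mul (pow_add_right h (by nlinarith)) _

/-! ### Relations in canonical form -/

/-- A cycle of length `n` run `p` times has length a positive multiple of `p`, which periodicity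
cuts down to `p`. -/
theorem IsCanonical.mem_pow_self {R : SetRel X X} (hR : IsCanonical R) {p : ℕ} (hp : 1 ≤ p)
    (h : ∀ n, 1 ≤ n → pow R (n + p) = pow R n) (x : X) : (x, x) ∈ pow R p := by
  obtain ⟨⟨n, hn, hx⟩, -⟩ : x ∈ recurrentSet R := hR.recurrent ▸ Set.mem_univ x
  have := mem_pow_mul_self hx p
  obtain ⟨m, rfl⟩ := Nat.exists_eq_add_of_le hn
  rwa [show (1 + m) * p = p + p * m by ring, pow_add_mul (h p hp)] at this

theorem Reaches.trans {R : SetRel X X} {x y z : X} :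
    Reaches R x y → Reaches R y z → Reaches R x z :=
  fun ⟨m, hm, h₁⟩ ⟨n, _, h₂⟩ => ⟨m + n, by omega, mem_pow_add h₁ h₂⟩

/-- Walks inside a component follow its bijection `f`, so two walks of the same length `p` from `x`,
ending at `x` and at `y`, have the same endpoint. -/
theorem IsCanonical.antisymm {R : SetRel X X} (hR : IsCanonical R) {p : ℕ} (hp : 1 ≤ p)
    (h : ∀ n, 1 ≤ n → pow R (n + p) = pow R n) {x y : X} (hxy : (x, y) ∈ pow R p)
    (hyx : (y, x) ∈ pow R p) : x = y := by
  have hx := hR.mem_pow_self hp h x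
  have hr : ∀ z, Reaches R z z := fun z => ⟨p, hp, hR.mem_pow_self hp h z⟩
  obtain ⟨f, -, hf⟩ := hR.bijective x
  have hxU : x ∈ component R x := ⟨hr x, hr x⟩
  have key : ∀ (n : ℕ) (y : X) (hy : y ∈ component R x), (x, y) ∈ pow R n →
      (⟨y, hy⟩ : component R x) = f^[n] ⟨x, hxU⟩ := by
    intro n
    induction n with
    | zero =>
      rintro y hy rfl
      rfl
    | succ n ih =>
      rintro y hy ⟨w, hw, hwy⟩
      have hwy' : Reaches R w y := ⟨1, Nat.one_pos, by rwa [pow_one]⟩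
      -- A walk that starts and ends in a component never leaves it.
      have hwU : w ∈ component R x := by
        refine ⟨?_, hwy'.trans hy.2⟩
        rcases Nat.eq_zero_or_pos n with rfl | hn
        · obtain rfl : x = w := hw
          exact hr x
        · exact ⟨n, hn, hw⟩
      have hm : ((⟨w, hwU⟩, ⟨y, hy⟩) : component R x × component R x) ∈
          restrict R (component R x) := hwy
      rw [hf] at hm
      rw [Function.iterate_succ_apply', ← ih w hwU hw]
      exact hm.symm
  have hyU : y ∈ component R x := ⟨⟨p, hp, hxy⟩, ⟨p, hp, hyx⟩⟩
  exact congrArg Subtype.val ((key p x hxU hx).trans (key p y hyU hxy).symm)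

/-- A pair of relations splitting the idempotents of two canonical forms comes from an
isomorphism of relations. -/
theorem IsCanonical.exists_equiv {X' : Type u} {R : SetRel X X} {R' : SetRel X' X'}
    (hR : IsCanonical R) (hR' : IsCanonical R') {p : ℕ} (hp : 1 ≤ p)
    (h : ∀ n, 1 ≤ n → pow R (n + p) = pow R n) (h' : ∀ n, 1 ≤ n → pow R' (n + p) = pow R' n)
    {S : SetRel X X'} {T : SetRel X' X} (hS : S ○ R' = R ○ S) (hT : T ○ R = R' ○ T)
    (hST : S ○ T = pow R p) (hTS : T ○ S = pow R' p) :
    ∃ φ : X ≃ X', ∀ x y, (φ x, φ y) ∈ R' ↔ (x, y) ∈ R := by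
  have e₁ : ∀ x, ∃ x', (x, x') ∈ S ∧ (x', x) ∈ T := fun x => by
    have := hR.mem_pow_self hp h x
    rwa [← hST] at this
  have e₂ : ∀ x', ∃ x, (x', x) ∈ T ∧ (x, x') ∈ S := fun x' => by
    have := hR'.mem_pow_self hp h' x'
    rwa [← hTS] at this
  choose φ hφ₁ hφ₂ using e₁
  choose ψ hψ₁ hψ₂ using e₂
  have m : ∀ {x y : X}, (∃ z, (x, z) ∈ S ∧ (z, y) ∈ T) → (x, y) ∈ pow R p :=
    fun hz => hST ▸ hz
  have m' : ∀ {x y : X'}, (∃ z, (x, z) ∈ T ∧ (z, y) ∈ S) → (x, y) ∈ pow R' p :=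
    fun hz => hTS ▸ hz
  -- Conjugation gives `R' ^ (p + 1)`, which is `R'` itself because periodicity holds from exponent
  -- 1 on.
  have c : T ○ R ○ S = R' := by
    rw [hT, SetRel.comp_assoc, hTS]
    rw [comp_pow, Nat.add_comm, h' 1 le_rfl, pow_one]
  have c' : S ○ R' ○ T = R := by
    rw [hS, SetRel.comp_assoc, hST]
    rw [comp_pow, Nat.add_comm, h 1 le_rfl, pow_one]
  refine ⟨⟨φ, ψ, fun x => ?_, fun x => ?_⟩, fun x y => ⟨fun hxy => ?_, fun hxy => ?_⟩⟩
  · exact hR.antisymm hp h (m ⟨φ x, hψ₂ _, hφ₂ _⟩) (m ⟨φ x, hφ₁ _, hψ₁ _⟩)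
  · exact hR'.antisymm hp h' (m' ⟨ψ x, hφ₂ _, hψ₂ _⟩) (m' ⟨ψ x, hψ₁ _, hφ₁ _⟩)
  · exact (Set.ext_iff.1 c' _).1 ⟨φ y, ⟨φ x, hφ₁ x, hxy⟩, hφ₂ y⟩
  · exact (Set.ext_iff.1 c _).1 ⟨y, ⟨x, hφ₂ x, hxy⟩, hφ₁ y⟩

/-- The relations of an isomorphism in the Szymczak category, normalised to splittings. -/
theorem IsCanonical.exists_equiv_of_shift {X' : Type u} {R : SetRel X X} {R' : SetRel X' X'}
    (hR : IsCanonical R) (hR' : IsCanonical R')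
    {S : SetRel X X'} {T : SetRel X' X} (hS : S ○ R' = R ○ S) (hT : T ○ R = R' ○ T) {c k l : ℕ}
    (hST : pow R k ○ (S ○ T) = pow R (c + k)) (hTS : pow R' l ○ (T ○ S) = pow R' (c + l)) :
    ∃ φ : X ≃ X', ∀ x y, (φ x, φ y) ∈ R' ↔ (x, y) ∈ R := by
  obtain ⟨p, ⟨hp, -⟩, hpR⟩ := hR.periodic
  obtain ⟨p', ⟨hp', -⟩, hpR'⟩ := hR'.periodic
  have hq : 1 ≤ p * p' := Nat.mul_pos hp hp'
  have hqR : ∀ n, 1 ≤ n → pow R (n + p * p') = pow R n := fun n hn => pow_add_mul (hpR n hn) _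
  have hqR' : ∀ n, 1 ≤ n → pow R' (n + p * p') = pow R' n := fun n hn => by
    rw [mul_comm]
    exact pow_add_mul (hpR' n hn) _
  generalize p * p' = q at hq hqR hqR'
  have comm : ∀ {Y Y' : Type u} {Q : SetRel Y Y} {Q' : SetRel Y' Y'} {P : SetRel Y Y'},
      P ○ Q' = Q ○ P → ∀ n, P ○ pow Q' n = pow Q n ○ P := by
    intro Y Y' Q Q' P hP n
    induction n with
    | zero => exact (SetRel.comp_id P).trans (SetRel.id_comp P).symm
    | succ n ih =>
      change P ○ (pow Q' n ○ Q') = pow Q n ○ Q ○ P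
      rw [← SetRel.comp_assoc, ih, SetRel.comp_assoc, hP, SetRel.comp_assoc]
  -- Trades the given exponent `k` for any `a ≥ 1`: adding `q * k` to `a` makes room to split off
  -- `k`, and is undone by periodicity.
  have absorb : ∀ {Y Y' : Type u} {Q : SetRel Y Y} {P : SetRel Y Y'} {P' : SetRel Y' Y} {k : ℕ},
      (∀ n, 1 ≤ n → pow Q (n + q) = pow Q n) → pow Q k ○ (P ○ P') = pow Q (c + k) →
      ∀ a, 1 ≤ a → pow Q a ○ (P ○ P') = pow Q (c + a) := by
    intro Y Y' Q P P' k hQ hk a ha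
    obtain ⟨d, hd⟩ : ∃ d, a + q * k = d + k := ⟨a + (q - 1) * k, by
      obtain ⟨r, rfl⟩ := Nat.exists_eq_add_of_le hq
      rw [Nat.add_sub_cancel_left]; ring⟩
    rw [← pow_add_mul (hQ a ha) k, hd, pow_add, SetRel.comp_assoc, hk, ← pow_add,
      show d + (c + k) = c + (d + k) by ring, ← hd, ← Nat.add_assoc, pow_add_mul (hQ _ (by omega))]
  -- This `a` makes `c + a` a positive multiple of `q`, so replacing `S` by `R ^ a` followed by `S`
  -- absorbs the shift `c`.
  obtain ⟨a, ha, n, hn⟩ : ∃ a, 1 ≤ a ∧ ∃ n, c + a = q + q * n :=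
    ⟨c * (q - 1) + q, by omega, c, by
      obtain ⟨r, rfl⟩ := Nat.exists_eq_add_of_le hq
      rw [Nat.add_sub_cancel_left]; ring⟩
  refine hR.exists_equiv hR' hq hqR hqR' (S := pow R a ○ S) (T := T) ?_ hT ?_ ?_
  · rw [SetRel.comp_assoc, hS, ← SetRel.comp_assoc, ← SetRel.comp_assoc, comp_pow]
    rfl
  · rw [SetRel.comp_assoc, absorb hqR hST a ha, hn, pow_add_mul (hqR q hq)]
  · rw [← SetRel.comp_assoc, comm hT, SetRel.comp_assoc, absorb hqR' hTS a ha, hn,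
      pow_add_mul (hqR' q hq)]

/-! ### Existence of the canonical form -/

/-- A sufficiently long walk in a finite set can be routed through a recurrent vertex. -/
theorem IsEventualPeriod.exists_mem_self [Finite X] {R : SetRel X X} {p : ℕ}
    (h : IsEventualPeriod R p) {x y : X} (hxy : (x, y) ∈ pow R p) :
    ∃ z, (x, z) ∈ pow R p ∧ (z, z) ∈ pow R p ∧ (z, y) ∈ pow R p := by
  -- Since `R ^ (2 * p) = R ^ p`, an `R ^ p`-step to `y` can be subdivided indefinitely; the
  -- resulting chain must revisit a point.
  have step : ∀ w : {w // (w, y) ∈ pow R p}, ∃ w' : {w // (w, y) ∈ pow R p},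
      (w.1, w'.1) ∈ pow R p := by
    rintro ⟨w, hw⟩
    rw [← h.2 p le_rfl, pow_add] at hw
    obtain ⟨v, hv, hv'⟩ := hw
    exact ⟨⟨v, hv'⟩, hv⟩
  choose g hg using step
  have trans : ∀ {a b c : X}, (a, b) ∈ pow R p → (b, c) ∈ pow R p → (a, c) ∈ pow R p := by
    intro a b c hab hbc
    have := mem_pow_add hab hbc
    rwa [h.2 p le_rfl] at this
  have chain : ∀ (w : {w // (w, y) ∈ pow R p}) (n : ℕ), (w.1, (g^[n + 1] w).1) ∈ pow R p := by
    intro w n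
    induction n with
    | zero => exact hg w
    | succ n ih =>
      rw [Function.iterate_succ_apply']
      exact trans ih (hg _)
  obtain ⟨i, j, hij, hw⟩ : ∃ i j, i < j ∧ g^[j] (g ⟨x, hxy⟩) = g^[i] (g ⟨x, hxy⟩) := by
    obtain ⟨i, j, hne, hw⟩ :=
      Finite.exists_ne_map_eq_of_infinite fun i => g^[i] (g ⟨x, hxy⟩)
    rcases hne.lt_or_gt with hlt | hlt
    · exact ⟨i, j, hlt, hw.symm⟩
    · exact ⟨j, i, hlt, hw⟩
  obtain ⟨d, rfl⟩ := Nat.exists_eq_add_of_lt hij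
  refine ⟨(g^[i] (g ⟨x, hxy⟩)).1, chain ⟨x, hxy⟩ i, ?_, (g^[i] (g ⟨x, hxy⟩)).2⟩
  have := chain (g^[i] (g ⟨x, hxy⟩)) d
  rwa [← Function.iterate_add_apply, show d + 1 + i = i + d + 1 by ring, hw] at this

/-- Every relation on a finite set splits, up to shift, through a relation in canonical form. -/
theorem exists_canonical [Finite X] (R : SetRel X X) :
    ∃ (Z : Type u) (_ : Finite Z) (Q : SetRel Z Z) (S : SetRel X Z) (T : SetRel Z X) (p : ℕ),
      IsCanonical Q ∧ S ○ Q = R ○ S ∧ T ○ R = Q ○ T ∧ S ○ T = pow R p ∧ T ○ S = pow Q p := by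
  obtain ⟨p, hp⟩ := exists_isEventualPeriod R
  have h1 : 1 ≤ p := hp.1
  let Y := {y : X // (y, y) ∈ pow R p}
  have trans : ∀ {a b c : X} (m n : ℕ), (a, b) ∈ pow R (p + m) → (b, c) ∈ pow R (p + n) →
      (a, c) ∈ pow R (p + (m + n)) := by
    intro a b c m n hab hbc
    have := mem_pow_add hab hbc
    rwa [show p + m + (p + n) = p + (m + n) + p by ring, hp.2 _ (by omega)] at this
  have trans₀ : ∀ {a b c : X}, (a, b) ∈ pow R p → (b, c) ∈ pow R p → (a, c) ∈ pow R p :=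
    fun hab hbc => trans 0 0 hab hbc
  let s : Setoid Y := ⟨fun a b => (a.1, b.1) ∈ pow R p ∧ (b.1, a.1) ∈ pow R p,
    fun a => ⟨a.2, a.2⟩, fun h => ⟨h.2, h.1⟩,
    fun h h' => ⟨trans₀ h.1 h'.1, trans₀ h'.2 h.2⟩⟩
  let Z := Quotient s
  let r : Z → X := fun z => z.out.1
  have r_self : ∀ z, (r z, r z) ∈ pow R p := fun z => z.out.2
  have r_inj : ∀ {z z' : Z}, (r z, r z') ∈ pow R p → (r z', r z) ∈ pow R p → z = z' := by
    intro z z' h h'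
    rw [← z.out_eq, ← z'.out_eq]
    exact Quotient.sound ⟨h, h'⟩
  have through : ∀ {x y : X} (n : ℕ), (x, y) ∈ pow R (p + n) →
      ∃ z, (x, r z) ∈ pow R p ∧ (r z, y) ∈ pow R (p + n) := by
    intro x y n hxy
    rw [pow_add] at hxy
    obtain ⟨w, hw, hwy⟩ := hxy
    obtain ⟨z, hz, hzz, hzw⟩ := hp.exists_mem_self hw
    have hs : ((Quotient.mk s ⟨z, hzz⟩).out.1, z) ∈ pow R p ∧ _ := Quotient.mk_out (s := s) ⟨z, hzz⟩
    exact ⟨Quotient.mk s ⟨z, hzz⟩, trans₀ hz hs.2, mem_pow_add (trans₀ hs.1 hzw) hwy⟩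
  -- The exponent `p + 1` rather than 1 allows passing to representatives before and after an
  -- `R`-step.
  let Q : SetRel Z Z := {a | (r a.1, r a.2) ∈ pow R (p + 1)}
  have hQ : ∀ n, 1 ≤ n → ∀ z z', (z, z') ∈ pow Q n ↔ (r z, r z') ∈ pow R (p + n) := by
    intro n hn
    induction n, hn using Nat.le_induction with
    | base => intro z z'; rw [pow_one]; rfl
    | succ n hn ih =>
      intro z z'
      constructor
      · rintro ⟨w, hw, hw'⟩
        exact trans _ _ ((ih _ _).1 hw) hw'
      · intro hz
        have : (r z, r z') ∈ pow R (p + n + (p + 1)) := by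
          rwa [show p + n + (p + 1) = p + (n + 1) + p by ring, hp.2 _ (by omega)]
        rw [pow_add] at this
        obtain ⟨w, hw, hw'⟩ := this
        obtain ⟨v, hv, hv'⟩ := through _ hw'
        exact ⟨v, (ih _ _).2 (trans n 0 hw hv), hv'⟩
  have hper : ∀ n, 1 ≤ n → pow Q (n + p) = pow Q n := by
    intro n hn
    ext ⟨z, z'⟩
    rw [hQ _ (by omega), hQ _ hn, ← Nat.add_assoc, hp.2 _ (by omega)]
  have hE : ∀ z z', (z, z') ∈ pow Q p ↔ (r z, r z') ∈ pow R p := by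
    intro z z'
    rw [hQ p h1, hp.2 p le_rfl]
  have mul_eq : ∀ n, 1 ≤ n → pow Q (n * (p - 1) + n) = pow Q p := by
    intro n hn
    obtain ⟨k, rfl⟩ := Nat.exists_eq_add_of_le hn
    obtain ⟨q, hq⟩ := Nat.exists_eq_add_of_le h1
    rw [show (1 + k) * (p - 1) + (1 + k) = p + p * k by
      rw [hq, Nat.add_sub_cancel_left]; ring, pow_add_mul (hper p h1)]
  -- Run the loop at `z` `p - 1` times, then step to `z'`: the total length `n * p` reduces to `p`.
  have left : ∀ {z z' : Z} (n : ℕ), 1 ≤ n → (z, z') ∈ pow Q n → (z, z) ∈ pow Q n →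
      (z, z') ∈ pow Q p := fun n hn h h' =>
    mul_eq n hn ▸ mem_pow_add (mem_pow_mul_self h' (p - 1)) h
  have right : ∀ {z z' : Z} (n : ℕ), 1 ≤ n → (z, z') ∈ pow Q n → (z', z') ∈ pow Q n →
      (z, z') ∈ pow Q p := fun n hn h h' => by
    rw [← mul_eq n hn, Nat.add_comm]
    exact mem_pow_add h (mem_pow_mul_self h' (p - 1))
  have anti : ∀ {z z' : Z}, (z, z') ∈ pow Q p → (z', z) ∈ pow Q p → z = z' :=
    fun h h' => r_inj ((hE _ _).1 h) ((hE _ _).1 h')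
  refine ⟨Z, inferInstance, Q, {a | (a.1, r a.2) ∈ pow R p}, {a | (r a.1, a.2) ∈ pow R p}, p,
    ⟨?_, ?_, p, ⟨h1, fun i hi => hper i (h1.trans hi)⟩, hper⟩, ?_, ?_, ?_, ?_⟩
  · refine Set.eq_univ_of_forall fun z => ?_
    have : Reaches Q z z := ⟨p, h1, (hE _ _).2 (r_self z)⟩
    exact ⟨this, this⟩
  · intro x
    have step : ∀ {a b : Z}, (a, b) ∈ Q → (a, b) ∈ pow Q 1 := fun h => by rwa [pow_one]
    have back : ∀ a b : component Q x, Reaches Q a b := fun a b => a.2.2.trans b.2.1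
    -- Returning from `b` to `a` and leaving for `b` or for `c` gives walks of equal length, so
    -- `left` relates `b` to `c`; by symmetry and antisymmetry they agree.
    have uniq : ∀ a b c : component Q x, (a.1, b.1) ∈ Q → (a.1, c.1) ∈ Q → b = c := by
      have aux : ∀ a b c : component Q x, (a.1, b.1) ∈ Q → (a.1, c.1) ∈ Q →
          (b.1, c.1) ∈ pow Q p := by
        intro a b c hb hc
        obtain ⟨n, hn, h⟩ := back b a
        exact left (n + 1) (by omega) (mem_pow_add h (step hc)) (mem_pow_add h (step hb))
      exact fun a b c hb hc => Subtype.ext (anti (aux a b c hb hc) (aux a c b hc hb))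
    have uniq' : ∀ a b c : component Q x, (b.1, a.1) ∈ Q → (c.1, a.1) ∈ Q → b = c := by
      have aux : ∀ a b c : component Q x, (b.1, a.1) ∈ Q → (c.1, a.1) ∈ Q →
          (b.1, c.1) ∈ pow Q p := by
        intro a b c hb hc
        obtain ⟨n, hn, h⟩ := back a c
        exact right (1 + n) (by omega) (mem_pow_add (step hb) h) (mem_pow_add (step hc) h)
      exact fun a b c hb hc => Subtype.ext (anti (aux a b c hb hc) (aux a c b hc hb))
    have total : ∀ a : component Q x, ∃ b : component Q x, (a.1, b.1) ∈ Q := by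
      intro a
      obtain ⟨n, hn, h⟩ := back a a
      obtain ⟨k, rfl⟩ := Nat.exists_eq_add_of_le' hn
      rw [← comp_pow] at h
      obtain ⟨w, hw, hwa⟩ := h
      refine ⟨⟨w, a.2.1.trans ⟨1, one_pos, step hw⟩, ?_⟩, hw⟩
      rcases Nat.eq_zero_or_pos k with rfl | hk
      · obtain rfl : w = a.1 := hwa
        exact a.2.2
      · exact Reaches.trans ⟨k, hk, hwa⟩ a.2.2
    choose f hf using total
    refine ⟨f, Finite.injective_iff_bijective.1 fun a b h => uniq' (f a) a b (hf a) (h ▸ hf b), ?_⟩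
    ext ⟨a, b⟩
    exact ⟨fun h => uniq a _ _ (hf a) h, fun h => (show f a = b from h) ▸ hf a⟩
  · ext ⟨x, z⟩
    constructor
    · rintro ⟨w, hw, hw'⟩
      have : (x, r z) ∈ pow R (p + 1) := trans 0 1 hw hw'
      rwa [← comp_pow] at this
    · rintro ⟨y, hy, hy'⟩
      exact through 1 ((Set.ext_iff.1 (comp_pow R p) _).1 ⟨y, hy, hy'⟩)
  · ext ⟨z, y⟩
    constructor
    · rintro ⟨x, hx, hx'⟩
      -- The extra period supplies a final `R ^ p`-step to route through a representative.
      have : (r z, y) ∈ pow R (p + 1 + p) := by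
        rw [hp.2 _ (by omega)]
        exact ⟨x, hx, hx'⟩
      rw [pow_add] at this
      obtain ⟨w, hw, hw'⟩ := this
      obtain ⟨v, hv, hv'⟩ := through 0 hw'
      exact ⟨v, trans 1 0 hw hv, hv'⟩
    · rintro ⟨w, hw, hw'⟩
      exact trans 1 0 hw hw'
  · ext ⟨x, y⟩
    exact ⟨fun ⟨z, hz, hz'⟩ => trans₀ hz hz', through 0⟩
  · ext ⟨z, z'⟩
    rw [hE]
    exact ⟨fun ⟨x, hx, hx'⟩ => trans₀ hx hx', fun h => ⟨r z, r_self z, h⟩⟩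

variable {X' : Type u}

/-! ### Invariance under isomorphisms of relations -/

theorem mem_pow_equiv {R : SetRel X X} {R' : SetRel X' X'} (φ : X ≃ X')
    (h : ∀ x y, (φ x, φ y) ∈ R' ↔ (x, y) ∈ R) (n : ℕ) (x y : X) :
    (φ x, φ y) ∈ pow R' n ↔ (x, y) ∈ pow R n := by
  induction n generalizing y with
  | zero => exact φ.apply_eq_iff_eq
  | succ n ih =>
    constructor
    · rintro ⟨w, hw, hwy⟩
      obtain ⟨w, rfl⟩ := φ.surjective w
      exact ⟨w, (ih w).1 hw, (h _ _).1 hwy⟩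
    · rintro ⟨w, hw, hwy⟩
      exact ⟨φ w, (ih w).2 hw, (h _ _).2 hwy⟩

theorem period_equiv {R : SetRel X X} {R' : SetRel X' X'} (φ : X ≃ X')
    (h : ∀ x y, (φ x, φ y) ∈ R' ↔ (x, y) ∈ R) : period R' = period R := by
  unfold period
  congr 1
  ext d
  exact forall_congr' fun n => by simp only [← φ.forall_congr_right (q := fun x => _),
    mem_pow_equiv φ h]

theorem restrict_equiv {R : SetRel X X} {R' : SetRel X' X'} (φ : X ≃ X')
    (h : ∀ x y, (φ x, φ y) ∈ R' ↔ (x, y) ∈ R) (U : Set X) (x y : U) :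
    (φ.image U x, φ.image U y) ∈ restrict R' (φ '' U) ↔ (x, y) ∈ restrict R U :=
  h x y

theorem compPeriod_equiv {R : SetRel X X} {R' : SetRel X' X'} (φ : X ≃ X')
    (h : ∀ x y, (φ x, φ y) ∈ R' ↔ (x, y) ∈ R) (U : Set X) :
    compPeriod R' (φ '' U) = compPeriod R U :=
  period_equiv (φ.image U) (restrict_equiv φ h U)

theorem walkResidue_equiv {R : SetRel X X} {R' : SetRel X' X'} (φ : X ≃ X')
    (h : ∀ x y, (φ x, φ y) ∈ R' ↔ (x, y) ∈ R) (U : Set X) (x y : U) :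
    walkResidue R' (φ '' U) (φ.image U x) (φ.image U y) = walkResidue R U x y := by
  unfold walkResidue
  rw [compPeriod_equiv φ h]
  simp only [mem_pow_equiv (φ.image U) (restrict_equiv φ h U)]

theorem connEquiv_equiv {R : SetRel X X} {R' : SetRel X' X'} (φ : X ≃ X')
    (h : ∀ x y, (φ x, φ y) ∈ R' ↔ (x, y) ∈ R) (U V : Set X) (a b : U × V) :
    ConnEquiv R' (φ '' U) (φ '' V) ((φ.image U).prodCongr (φ.image V) a)
      ((φ.image U).prodCongr (φ.image V) b) ↔ ConnEquiv R U V a b := by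
  unfold ConnEquiv
  simp only [compPeriod_equiv φ h, Equiv.prodCongr_apply, Prod.map_fst, Prod.map_snd,
    walkResidue_equiv φ h]

theorem numConnections_equiv {R : SetRel X X} {R' : SetRel X' X'} (φ : X ≃ X')
    (h : ∀ x y, (φ x, φ y) ∈ R' ↔ (x, y) ∈ R) (U V : Set X) :
    numConnections R' (φ '' U) (φ '' V) = numConnections R U V := by
  let e := (φ.image U).prodCongr (φ.image V)
  have he : ∀ a, e '' {b | ConnEquiv R U V a b} =
      {b | ConnEquiv R' (φ '' U) (φ '' V) (e a) b} := by
    intro a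
    ext b
    obtain ⟨b, rfl⟩ := e.surjective b
    rw [e.injective.mem_set_image]
    exact (connEquiv_equiv φ h U V a b).symm
  unfold numConnections
  -- Counts classes by transporting them, as sets, along `e`.
  rw [← Set.ncard_image_of_injective _ (Set.image_injective.2 e.injective)]
  congr 1
  ext c
  constructor
  · rintro ⟨a, ha, rfl⟩
    obtain ⟨a, rfl⟩ := e.surjective a
    exact ⟨_, ⟨a, (h _ _).1 ha, rfl⟩, he a⟩
  · rintro ⟨_, ⟨a, ha, rfl⟩, rfl⟩
    exact ⟨e a, (h _ _).2 ha, he a⟩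

theorem stronglyConn_equiv {R : SetRel X X} {R' : SetRel X' X'} (φ : X ≃ X')
    (h : ∀ x y, (φ x, φ y) ∈ R' ↔ (x, y) ∈ R) (x y : X) :
    StronglyConn R' (φ x) (φ y) ↔ StronglyConn R x y := by
  simp only [StronglyConn, Reaches, mem_pow_equiv φ h]

theorem image_component {R : SetRel X X} {R' : SetRel X' X'} (φ : X ≃ X')
    (h : ∀ x y, (φ x, φ y) ∈ R' ↔ (x, y) ∈ R) (x : X) :
    φ '' component R x = component R' (φ x) := by
  ext y
  obtain ⟨y, rfl⟩ := φ.surjective y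
  rw [φ.injective.mem_set_image]
  exact (stronglyConn_equiv φ h x y).symm

theorem image_mem_components {R : SetRel X X} {R' : SetRel X' X'} (φ : X ≃ X')
    (h : ∀ x y, (φ x, φ y) ∈ R' ↔ (x, y) ∈ R) (U : Set X) :
    U ∈ components R ↔ φ '' U ∈ components R' := by
  constructor
  · rintro ⟨x, hx, rfl⟩
    exact ⟨φ x, (stronglyConn_equiv φ h x x).2 hx, (image_component φ h x).symm⟩
  · rintro ⟨x, hx, hU⟩
    obtain ⟨x, rfl⟩ := φ.surjective x
    exact ⟨x, (stronglyConn_equiv φ h x x).1 hx,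
      φ.injective.image_injective ((image_component φ h x).trans hU)⟩

end FinRel

/-- An isomorphism of relations induces an isomorphism of their graphs of components. -/
noncomputable def componentGraphIso {X X' : Type u} {R : SetRel X X} {R' : SetRel X' X'}
    (φ : X ≃ X') (h : ∀ x y, (φ x, φ y) ∈ R' ↔ (x, y) ∈ R) :
    LabelledDigraph.Iso (componentGraph R) (componentGraph R') where
  toRelIso :=
    { toEquiv := (Equiv.Set.congr φ).subtypeEquiv (FinRel.image_mem_components φ h)
      map_rel_iff' := fun {U V} => by
        exact and_congr (iff_of_eq (congrArg (· ≠ 0) (FinRel.numConnections_equiv φ h U.1 V.1)))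
          (Equiv.injective _).ne_iff }
  vertexLabel_eq U := FinRel.compPeriod_equiv φ h U.1
  edgeLabel_eq U V _ := FinRel.numConnections_equiv φ h U.1 V.1

/-! ### The Szymczak category of finite relations -/

namespace EndoCat

/-- The relation of a morphism of `FRel` between the sets underlying objects of `Endo(FRel)`. -/
def homRel {A B : EndoCat FRel.{u}} (f : A.obj ⟶ B.obj) : SetRel A.carrier B.carrier :=
  RelCat.Hom.rel (InducedCategory.Hom.hom f)

theorem homRel_injective {A B : EndoCat FRel.{u}} {f g : A.obj ⟶ B.obj}
    (h : homRel f = homRel g) : f = g :=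
  InducedCategory.hom_ext (RelCat.Hom.ext _ _ h)

theorem homRel_comp {A B D : EndoCat FRel.{u}} (f : A.obj ⟶ B.obj) (g : B.obj ⟶ D.obj) :
    homRel (f ≫ g) = homRel f ○ homRel g := rfl

theorem homRel_pow (A : EndoCat FRel.{u}) (n : ℕ) :
    homRel (A.endo ^ n : End A.obj) = FinRel.pow A.rel n := by
  induction n with
  | zero => rfl
  | succ n ih =>
    rw [pow_succ', End.mul_def, homRel_comp, ih]
    rfl

/-- The object `(X, R)` of `Endo(FRel)`. -/
def ofRel {X : Type u} [Finite X] (R : SetRel X X) : EndoCat FRel.{u} where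
  obj := ⟨X, ‹_›⟩
  endo := InducedCategory.homMk (RelCat.Hom.ofRel R)

/-- The morphism of `Endo(FRel)` given by a relation commuting with the endomorphisms. -/
def homOfRel {A B : EndoCat FRel.{u}} (S : SetRel A.carrier B.carrier)
    (h : S ○ B.rel = A.rel ○ S) : A ⟶ B where
  hom := InducedCategory.homMk (RelCat.Hom.ofRel S)
  comm := homRel_injective h

end EndoCat

namespace Szym

open EndoCat

/-- The classes `[S, p]` and `[T, 0]` are inverse, since `[R ^ p, p]` is the identity. -/
theorem nonempty_iso_of_rel {A B : EndoCat FRel.{u}} {S : SetRel A.carrier B.carrier}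
    {T : SetRel B.carrier A.carrier} {p : ℕ} (hS : S ○ B.rel = A.rel ○ S)
    (hT : T ○ A.rel = B.rel ○ T) (hST : S ○ T = FinRel.pow A.rel p)
    (hTS : T ○ S = FinRel.pow B.rel p) : Nonempty (Szym.of A ≅ Szym.of B) := by
  refine ⟨⟨Quotient.mk (homSetoid A B) (homOfRel S hS, p), Quotient.mk (homSetoid B A)
    (homOfRel T hT, 0), Quotient.sound ⟨0, homRel_injective ?_⟩,
    Quotient.sound ⟨0, homRel_injective ?_⟩⟩⟩
  · have : SetRel.id ○ (S ○ T) =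
        EndoCat.homRel (A.endo ^ (p + 0 + 0) : End A.obj) ○ SetRel.id := by
      rw [homRel_pow, hST, SetRel.id_comp, SetRel.comp_id]
      rfl
    exact this
  · have : SetRel.id ○ (T ○ S) =
        EndoCat.homRel (B.endo ^ (0 + p + 0) : End B.obj) ○ SetRel.id := by
      rw [homRel_pow, hTS, SetRel.id_comp, SetRel.comp_id, Nat.zero_add]
      rfl
    exact this

/-- The shifts of the two representatives add up to the same `c` in both composites; `k` and `l`
witness the two equivalences with the identity. -/
theorem exists_rel_of_iso {A B : EndoCat FRel.{u}} (i : Szym.of A ≅ Szym.of B) :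
    ∃ (S : SetRel A.carrier B.carrier) (T : SetRel B.carrier A.carrier) (c k l : ℕ),
      S ○ B.rel = A.rel ○ S ∧ T ○ A.rel = B.rel ○ T ∧
      FinRel.pow A.rel k ○ (S ○ T) = FinRel.pow A.rel (c + k) ∧
      FinRel.pow B.rel l ○ (T ○ S) = FinRel.pow B.rel (c + l) := by
  obtain ⟨f, g, hfg, hgf⟩ := i
  obtain ⟨⟨f, m⟩, rfl⟩ := Quotient.exists_rep f
  obtain ⟨⟨g, n⟩, rfl⟩ := Quotient.exists_rep g
  obtain ⟨k, hk⟩ := Quotient.exact hfg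
  obtain ⟨l, hl⟩ := Quotient.exact hgf
  refine ⟨EndoCat.homRel f.hom, EndoCat.homRel g.hom, m + n, k, l,
    congrArg EndoCat.homRel f.comm, congrArg EndoCat.homRel g.comm, ?_, ?_⟩
  · have : EndoCat.homRel (A.endo ^ (0 + k) : End A.obj) ○
        (EndoCat.homRel f.hom ○ EndoCat.homRel g.hom) =
        EndoCat.homRel (A.endo ^ (m + n + k) : End A.obj) ○ SetRel.id :=
      congrArg EndoCat.homRel hk
    rwa [homRel_pow, homRel_pow, SetRel.comp_id, Nat.zero_add] at this
  · have : EndoCat.homRel (B.endo ^ (0 + l) : End B.obj) ○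
        (EndoCat.homRel g.hom ○ EndoCat.homRel f.hom) =
        EndoCat.homRel (B.endo ^ (n + m + l) : End B.obj) ○ SetRel.id :=
      congrArg EndoCat.homRel hl
    rwa [homRel_pow, homRel_pow, SetRel.comp_id, Nat.zero_add, Nat.add_comm n] at this

end Szym

/-! ### Existence and uniqueness of the classifying graph -/

theorem exists_isClassifyingGraph (A : EndoCat FRel.{u}) :
    ∃ G : LabelledDigraph.{u}, IsClassifyingGraph A G := by
  obtain ⟨Z, _, Q, S, T, p, hQ, hS, hT, hST, hTS⟩ := FinRel.exists_canonical A.rel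
  exact ⟨_, EndoCat.ofRel Q, hQ, Szym.nonempty_iso_of_rel (B := EndoCat.ofRel Q) hS hT hST hTS, rfl⟩

theorem mainTheorem3 (A B : EndoCat FRel.{u}) (h : Nonempty (Szym.of A ≅ Szym.of B)) :
    (∃ G : LabelledDigraph.{u}, IsClassifyingGraph A G) ∧
    (∃ H : LabelledDigraph.{u}, IsClassifyingGraph B H) ∧
    ∀ G H : LabelledDigraph.{u}, IsClassifyingGraph A G → IsClassifyingGraph B H →
      Nonempty (LabelledDigraph.Iso G H) := by
  refine ⟨exists_isClassifyingGraph A, exists_isClassifyingGraph B, ?_⟩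
  rintro _ _ ⟨C, hC, ⟨i⟩, rfl⟩ ⟨D, hD, ⟨j⟩, rfl⟩
  obtain ⟨h⟩ := h
  obtain ⟨S, T, c, k, l, hS, hT, hST, hTS⟩ := Szym.exists_rel_of_iso (i.symm ≪≫ h ≪≫ j)
  obtain ⟨φ, hφ⟩ := hC.exists_equiv_of_shift hD hS hT hST hTS
  exact ⟨componentGraphIso φ hφ⟩
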